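/- Conventions. $\mathbb R_+=[0,\infty)$. A property $P(s)$ holds in a neighborhood of $\infty$ (of $0$) if there is $s_0>0$ such that $P(s)$ holds for all $s\ge s_0$ (for all $0<s\le s_0$). A *large scale dim-control function* is a continuous (weakly) increasing $g:\mathbb R_+\to\mathbb R_+$ with $g(x)\ge x$ in a neighborhood of $\infty$ and $\lim_{x\to\infty}g(x)=\infty$; it is a *global* dim-control function if moreover $g(x)\ge x$ in a neighborhood of $0$ and $g(0)=0$. A *control semigroup* is a set $\mathcal S$ of large scale dim-control functions that is closed under composition and contains every large scale dim-control function that agrees with a linear function $x\mapsto cx$ in a neighborhood of $\infty$. A *global control semigroup* is a set $\bar{\mathcal S}$ of global dim-control functions that is closed under composition and contains every global dim-control function that agrees with a linear function $x\mapsto cx$ in a neighborhood of $\infty$ and with a linear function $x\mapsto c'x$ in a neighborhood of $0$. A family of subsets of a metric space is $C$-bounded if its members have diameter at most $C$, and $s$-disjoint if $d(U,V)=\inf_{u\in U,v\in V}d(u,v)>s$ for any two distinct members $U,V$. For a control semigroup $\mathcal S$, $\operatorname{asdim}_{\mathcal S}X\le n$ means that there is $g\in\mathcal S$ such that for every $s$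 in a neighborhood of $\infty$ there is a cover $\mathcal U=\bigcup_{i=1}^{n+1}\mathcal U_i$ of $X$ with every $\mathcal U_i$ $s$-disjoint and $g(s)$-bounded. For a global control semigroup $\bar{\mathcal S}$, $\dim_{\bar{\mathcal S}}X\le n$ means that there is $g\in\bar{\mathcal S}$ for which such covers exist for every $s>0$. For a control semigroup $\mathcal S$, $\Sigma(\mathcal S)$ is the set of continuous increasing $\rho:\mathbb R_+\to\mathbb R_+$ with $\lim_{x\to\infty}\rho(x)=\infty$ for which there is $g\in\mathcal S$ with $g\ge\rho$ in a neighborhood of $\infty$. For a global control semigroup $\bar{\mathcal S}$ one requires in addition $\rho(0)=0$, and $g\ge\rho$ both in a neighborhood of $0$ and in a neighborhood of $\infty$. A map $f:X\to Y$ of metric spaces is $\Sigma(\mathcal S)$-coarse (resp. a global $\Sigma(\bar{\mathcal S})$-function) if there is $\rho\in\Sigma(\mathcal S)$ (resp. $\rho\in\Sigma(\bar{\mathcal S})$) with $d_Y(f(x),f(y))\le\rho(d_X(x,y))$ for all $x,y\in X$. Let $f:X\to Y$ be a map of metric spaces and $k\ge m+1\ge1$. A set $A\subset X$ is $(\infty,R)$-bounded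 if $d_Y(f(x),f(y))\le R$ for all $x,y\in A$. An $r$-component of a set is a class of its points under being joined by a finite chain in the set with consecutive points at distance at most $r$. An $(m,k)$-dimensional $(\mathcal S_1,\mathcal S_2)$-control function of $f$ is a function $D:\mathbb R_+\times\mathbb R_+\to\mathbb R_+$ such that 1. for all $\rho_1\in\mathcal S_1$ and $\delta\in\mathcal S_2$ there is $\rho_2\in\mathcal S_1$ with $D(\rho_1(x),\delta(x))\le\rho_2(x)$ in a neighborhood of $\infty$; 2. there is $s_0>0$ such that for all $r,R\ge s_0$ every $(\infty,R)$-bounded $A\subset X$ is a union of $k$ sets $A_1,\dots,A_k$ whose $r$-components are $D(r,R)$-bounded and such that every $x\in A$ belongs to $A_i$ for at least $k-m$ indices $i$. For global control semigroups $\bar{\mathcal S}_1,\bar{\mathcal S}_2$, the inequality in 1 is required both in a neighborhood of $0$ and in a neighborhood of $\infty$ (with the same $\rho_2$), and the decompositions in 2 are required for all $r,R\ge s_0$ with some $s_0>0$ and for all $0<r,R\le s_1$ with some $s_1>0$. **Proposition.** Let $X,Y$ be metric spaces, $f:X\to Y$ a map, $m,n\ge0$ integers and $k=m+n+1$. (a)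 Let $\mathcal S_1,\mathcal S_2$ be control semigroups. If $f$ is $\Sigma(\mathcal S_2)$-coarse, $\operatorname{asdim}_{\mathcal S_2}Y\le n$, and $f$ has an $(m,k)$-dimensional $(\mathcal S_1,\mathcal S_2)$-control function, then $\operatorname{asdim}_{\mathcal S_1}X\le m+n$. (b) Let $\bar{\mathcal S}_1,\bar{\mathcal S}_2$ be global control semigroups. If $f$ is a global $\Sigma(\bar{\mathcal S}_2)$-function, $\dim_{\bar{\mathcal S}_2}Y\le n$, and $f$ has an $(m,k)$-dimensional $(\bar{\mathcal S}_1,\bar{\mathcal S}_2)$-control function, then $\dim_{\bar{\mathcal S}_1}X\le m+n$. -/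

import Mathlib

open Filter Topology
open scoped NNReal ENNReal

namespace SemigroupDim

/-! ### Neighbourhoods of infinity and of zero, dim-control functions

`ℝ₊ = [0, ∞)` is `ℝ≥0`.  A property holds in a neighbourhood of `∞` when it holds eventually along
`atTop`, and in a neighbourhood of `0` when it holds for all small positive `s`, i.e. eventually
along `𝓝[>] 0`. -/

/-- Large scale (asymptotic) dim-control functions. -/
structure IsLargeDimControl (f : ℝ≥0 → ℝ≥0) : Prop where
  monotone : Monotone f
  continuous : Continuous f
  le_self : ∀ᶠ x in atTop, x ≤ f x
  tendsto : Tendsto f atTop atTop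

/-- Small scale dim-control functions. -/
structure IsSmallDimControl (f : ℝ≥0 → ℝ≥0) : Prop where
  monotone : Monotone f
  continuous : Continuous f
  le_self : ∀ᶠ x in 𝓝[>] 0, x ≤ f x
  map_zero : f 0 = 0

/-- Global dim-control functions. -/
def IsGlobalDimControl (f : ℝ≥0 → ℝ≥0) : Prop :=
  IsSmallDimControl f ∧ IsLargeDimControl f

/-- `f` is equal to a linear function in a neighbourhood of `∞`. -/
def IsLinearAtInfinity (f : ℝ≥0 → ℝ≥0) : Prop :=
  ∃ c : ℝ≥0, ∀ᶠ x in atTop, f x = c * x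

/-- `f` is equal to a linear function in a neighbourhood of `0`. -/
def IsLinearAtZero (f : ℝ≥0 → ℝ≥0) : Prop :=
  ∃ c : ℝ≥0, ∀ᶠ x in 𝓝[>] 0, f x = c * x

/-! ### Control semigroups -/

/-- Large scale (asymptotic) control semigroups. -/
structure IsControlSemigroup (S : Set (ℝ≥0 → ℝ≥0)) : Prop where
  dimControl : ∀ f ∈ S, IsLargeDimControl f
  linear_mem : ∀ f, IsLargeDimControl f → IsLinearAtInfinity f → f ∈ S
  comp_mem : ∀ g₁ ∈ S, ∀ g₂ ∈ S, g₁ ∘ g₂ ∈ S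

/-- Global control semigroups. -/
structure IsGlobalControlSemigroup (S : Set (ℝ≥0 → ℝ≥0)) : Prop where
  dimControl : ∀ f ∈ S, IsGlobalDimControl f
  linear_mem : ∀ f, IsGlobalDimControl f → IsLinearAtZero f → IsLinearAtInfinity f → f ∈ S
  comp_mem : ∀ g₁ ∈ S, ∀ g₂ ∈ S, g₁ ∘ g₂ ∈ S

/-! ### Coloured covers and semigroup-controlled dimensions -/

section Metric

variable {X Y : Type*} [MetricSpace X] [MetricSpace Y]

/-- `U` has diameter at most `C`. -/
def BoundedBy (C : ℝ≥0) (U : Set X) : Prop :=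
  ∀ x ∈ U, ∀ y ∈ U, nndist x y ≤ C

/-- The distance `d(U, V)` between two sets, as an infimum (it is `∞` if one of them is empty). -/
noncomputable def setEDist (U V : Set X) : ℝ≥0∞ :=
  ⨅ x ∈ U, ⨅ y ∈ V, edist x y

/-- A family of sets is `s`-disjoint if `d(U, V) > s` for any two distinct members `U`, `V`. -/
def SDisjoint (s : ℝ≥0) (𝒰 : Set (Set X)) : Prop :=
  ∀ U ∈ 𝒰, ∀ V ∈ 𝒰, U ≠ V → (s : ℝ≥0∞) < setEDist U V

variable (X) in
/-- `X` has a cover `𝒰 = 𝒰₀ ∪ ⋯ ∪ 𝒰ₙ`, with each of the `n + 1` families `𝒰ᵢ` being `s`-disjoint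
and `C`-bounded. -/
def HasColoredCover (n : ℕ) (s C : ℝ≥0) : Prop :=
  ∃ 𝒰 : Fin (n + 1) → Set (Set X),
    (∀ x : X, ∃ i, ∃ U ∈ 𝒰 i, x ∈ U) ∧
    (∀ i, SDisjoint s (𝒰 i)) ∧
    (∀ i, ∀ U ∈ 𝒰 i, BoundedBy C U)

variable (X) in
/-- `asdim_S X ≤ n`. -/
def AsdimLE (S : Set (ℝ≥0 → ℝ≥0)) (n : ℕ) : Prop :=
  ∃ g ∈ S, ∀ᶠ s in atTop, HasColoredCover X n s (g s)

variable (X) in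
/-- `dim_S X ≤ n`, for a global control semigroup `S`. -/
def GlobalDimLE (S : Set (ℝ≥0 → ℝ≥0)) (n : ℕ) : Prop :=
  ∃ g ∈ S, ∀ s : ℝ≥0, 0 < s → HasColoredCover X n s (g s)

/-! ### The metric perturbation set generated by a control semigroup, and the associated maps -/

/-- The large scale metric perturbation set `Σ(S)`. -/
def perturbationSet (S : Set (ℝ≥0 → ℝ≥0)) : Set (ℝ≥0 → ℝ≥0) :=
  {ρ | Monotone ρ ∧ Continuous ρ ∧ Tendsto ρ atTop atTop ∧
    ∃ g ∈ S, ∀ᶠ x in atTop, ρ x ≤ g x}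

/-- The global metric perturbation set `Σ(S)`. -/
def globalPerturbationSet (S : Set (ℝ≥0 → ℝ≥0)) : Set (ℝ≥0 → ℝ≥0) :=
  {ρ | Monotone ρ ∧ Continuous ρ ∧ ρ 0 = 0 ∧ Tendsto ρ atTop atTop ∧
    ∃ g ∈ S, (∀ᶠ x in 𝓝[>] 0, ρ x ≤ g x) ∧ ∀ᶠ x in atTop, ρ x ≤ g x}

/-- `f` is a `Σ(S)`-coarse map. -/
def IsCoarseMap (S : Set (ℝ≥0 → ℝ≥0)) (f : X → Y) : Prop :=
  ∃ ρ ∈ perturbationSet S, ∀ x y, nndist (f x) (f y) ≤ ρ (nndist x y)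

/-- `f` is a global `Σ(S)`-map. -/
def IsGlobalMap (S : Set (ℝ≥0 → ℝ≥0)) (f : X → Y) : Prop :=
  ∃ ρ ∈ globalPerturbationSet S, ∀ x y, nndist (f x) (f y) ≤ ρ (nndist x y)

/-! ### Control functions of maps -/

/-- `D` is an `(S₁, S₂)`-function (large scale). -/
def IsPairFunction (S₁ S₂ : Set (ℝ≥0 → ℝ≥0)) (D : ℝ≥0 → ℝ≥0 → ℝ≥0) : Prop :=
  ∀ ρ₁ ∈ S₁, ∀ δ ∈ S₂, ∃ ρ₂ ∈ S₁, ∀ᶠ x in atTop, D (ρ₁ x) (δ x) ≤ ρ₂ x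

/-- `D` is an `(S₁, S₂)`-function (global). -/
def IsGlobalPairFunction (S₁ S₂ : Set (ℝ≥0 → ℝ≥0)) (D : ℝ≥0 → ℝ≥0 → ℝ≥0) : Prop :=
  ∀ ρ₁ ∈ S₁, ∀ δ ∈ S₂, ∃ ρ₂ ∈ S₁,
    (∀ᶠ x in 𝓝[>] 0, D (ρ₁ x) (δ x) ≤ ρ₂ x) ∧ ∀ᶠ x in atTop, D (ρ₁ x) (δ x) ≤ ρ₂ x

/-- `A` is `(∞, R)`-bounded with respect to `f`. -/
def InftyBounded (f : X → Y) (R : ℝ≥0) (A : Set X) : Prop :=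
  ∀ x ∈ A, ∀ y ∈ A, nndist (f x) (f y) ≤ R

/-- The `r`-component of `A` at a point `x` of `A`: the points reachable from `x` by a finite chain
in `A` whose consecutive points are at distance at most `r`. -/
def rComponent (r : ℝ≥0) (A : Set X) (x : X) : Set X :=
  {y | Relation.ReflTransGen (fun a b => a ∈ A ∧ b ∈ A ∧ nndist a b ≤ r) x y}

/-- All `r`-components of `A` are `C`-bounded. -/
def ComponentsBounded (r C : ℝ≥0) (A : Set X) : Prop :=
  ∀ x ∈ A, BoundedBy C (rComponent r A x)

/-- `A` is a union of `k` sets `A₁, …, A_k`, all of whose `r`-components are `C`-bounded, such that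
each point of `A` belongs to `A_i` for at least `k - m` indices `i`. -/
def HasDecomposition (m k : ℕ) (r C : ℝ≥0) (A : Set X) : Prop :=
  ∃ B : Fin k → Set X, A = ⋃ i, B i ∧
    (∀ i, ComponentsBounded r C (B i)) ∧
    ∀ x ∈ A, k - m ≤ {i | x ∈ B i}.ncard

/-- `D` is an `(m, k)`-dimensional `(S₁, S₂)`-control function of `f` (large scale), `k ≥ m + 1`. -/
def IsControlFunction (S₁ S₂ : Set (ℝ≥0 → ℝ≥0)) (m k : ℕ) (f : X → Y)
    (D : ℝ≥0 → ℝ≥0 → ℝ≥0) : Prop :=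
  IsPairFunction S₁ S₂ D ∧
    ∃ s₀ : ℝ≥0, 0 < s₀ ∧ ∀ r R : ℝ≥0, s₀ ≤ r → s₀ ≤ R →
      ∀ A : Set X, InftyBounded f R A → HasDecomposition m k r (D r R) A

/-- `D` is an `(m, k)`-dimensional `(S₁, S₂)`-control function of `f` (global), `k ≥ m + 1`: the
decompositions exist for `r`, `R` in a neighbourhood of `0` and for `r`, `R` in a neighbourhood
of `∞`. -/
def IsGlobalControlFunction (S₁ S₂ : Set (ℝ≥0 → ℝ≥0)) (m k : ℕ) (f : X → Y)
    (D : ℝ≥0 → ℝ≥0 → ℝ≥0) : Prop :=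
  IsGlobalPairFunction S₁ S₂ D ∧
    (∃ s₀ : ℝ≥0, 0 < s₀ ∧ ∀ r R : ℝ≥0, 0 < r → r ≤ s₀ → 0 < R → R ≤ s₀ →
      ∀ A : Set X, InftyBounded f R A → HasDecomposition m k r (D r R) A) ∧
    ∃ s₀ : ℝ≥0, 0 < s₀ ∧ ∀ r R : ℝ≥0, s₀ ≤ r → s₀ ≤ R →
      ∀ A : Set X, InftyBounded f R A → HasDecomposition m k r (D r R) A

end Metric

end SemigroupDim

namespace SemigroupDim

/-! ### Components at a fixed scale. -/

section Components

variable {X Y : Type*} [MetricSpace X] [MetricSpace Y]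

/-! Kolmogorov's trick enlarges the `n + 1` colours of `Y` to `k = m + n + 1` sets `Z i` such that
each point lies in at least `m + 1` of them (`HasDecomposition.succ`). A coarser cover `V t` of `Y`
has `n + 1` colours, and the preimage of each of its components splits into `k` sets covering each
point at least `n + 1` times. As `(m + 1) + (n + 1) > k`, each `x` has an index `i` good for both
families; this defines a cover of `X` in `k` colours. An `r`-component of colour `i` maps into one
component of `Z i`, so its image is too small to meet two components of the same `V t`. It therefore
lies in a union of `n + 1` controlled sets, and the union theorem at nested scales bounds it
(`exists_cover_componentsBounded`). The bounds arise from finitely many compositions and constant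
factors, so they stay in the semigroup. Working along a filter `l` treats (a), with `atTop`, and
(b), with `𝓝[>] 0 ⊔ atTop`, together; in (b) the intermediate scales cost only a constant factor. -/

theorem BoundedBy.mono {C C' : ℝ≥0} {U U' : Set X} (h : BoundedBy C U) (hC : C ≤ C')
    (hU : U' ⊆ U) : BoundedBy C' U' :=
  fun x hx y hy => (h x (hU hx) y (hU hy)).trans hC

theorem mem_rComponent_self (r : ℝ≥0) (A : Set X) (x : X) : x ∈ rComponent r A x :=
  Relation.ReflTransGen.refl

theorem rComponent_mono {r r' : ℝ≥0} {A A' : Set X} (hr : r ≤ r') (hA : A ⊆ A') (x : X) :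
    rComponent r A x ⊆ rComponent r' A' x := by
  intro y hy
  induction hy with
  | refl => exact Relation.ReflTransGen.refl
  | tail _ h ih => exact ih.tail ⟨hA h.1, hA h.2.1, h.2.2.trans hr⟩

theorem rComponent_subset {r : ℝ≥0} {A : Set X} {x : X} (hx : x ∈ A) : rComponent r A x ⊆ A := by
  intro y hy
  induction hy with
  | refl => exact hx
  | tail _ h _ => exact h.2.1

theorem rComponent_trans {r : ℝ≥0} {A : Set X} {x y z : X} (h : y ∈ rComponent r A x)
    (h' : z ∈ rComponent r A y) : z ∈ rComponent r A x :=
  Relation.ReflTransGen.trans h h'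

theorem rComponent_symm {r : ℝ≥0} {A : Set X} {x y : X} (h : y ∈ rComponent r A x) :
    x ∈ rComponent r A y := by
  induction h with
  | refl => exact Relation.ReflTransGen.refl
  | tail _ h ih =>
    exact Relation.ReflTransGen.head ⟨h.2.1, h.1, by rw [nndist_comm]; exact h.2.2⟩ ih

theorem rComponent_step {r : ℝ≥0} {A : Set X} {x y z : X} (h : y ∈ rComponent r A x)
    (hy : y ∈ A) (hz : z ∈ A) (hyz : nndist y z ≤ r) : z ∈ rComponent r A x :=
  Relation.ReflTransGen.tail h ⟨hy, hz, hyz⟩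

theorem rComponent_eq {r : ℝ≥0} {A : Set X} {x y : X} (h : y ∈ rComponent r A x) :
    rComponent r A y = rComponent r A x :=
  Set.Subset.antisymm (fun _ hz => rComponent_trans h hz)
    (fun _ hz => rComponent_trans (rComponent_symm h) hz)

theorem rComponent_eq_of_nndist_le {r : ℝ≥0} {A : Set X} {x y : X} (hx : x ∈ A) (hy : y ∈ A)
    (h : nndist x y ≤ r) : rComponent r A y = rComponent r A x :=
  rComponent_eq (rComponent_step (mem_rComponent_self r A x) hx hy h)

/-- A component lying in a set `A'` is contained in a component of `A'`. -/
theorem rComponent_subset_rComponent {r : ℝ≥0} {A A' : Set X} {x : X}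
    (h : rComponent r A x ⊆ A') : rComponent r A x ⊆ rComponent r A' x := by
  intro y hy
  induction hy with
  | refl => exact mem_rComponent_self r A' x
  | tail hyz hz ih => exact rComponent_step ih (h hyz) (h (hyz.tail hz)) hz.2.2

theorem ComponentsBounded.mono {r r' C C' : ℝ≥0} {A A' : Set X} (h : ComponentsBounded r C A)
    (hr : r' ≤ r) (hC : C ≤ C') (hA : A' ⊆ A) : ComponentsBounded r' C' A' :=
  fun x hx => (h x (hA hx)).mono hC (rComponent_mono hr hA x)

theorem HasDecomposition.mono {m k : ℕ} {r C C' : ℝ≥0} {A : Set X}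
    (h : HasDecomposition m k r C A) (hC : C ≤ C') : HasDecomposition m k r C' A := by
  obtain ⟨B, hB, hb, hn⟩ := h
  exact ⟨B, hB, fun i => (hb i).mono le_rfl hC subset_rfl, hn⟩

/-! ### Unions and neighbourhoods. -/

/-- The union theorem for two sets at nested scales. -/
theorem ComponentsBounded.union {r a b e : ℝ≥0} {A B : Set X} (hA : ComponentsBounded r e A)
    (hB : ComponentsBounded a b B) (ha : e + 2 * r ≤ a) :
    ComponentsBounded r (b + 2 * (e + r)) (A ∪ B) := by
  -- Each excursion of a chain from `B` into `A` stays in one `r`-component of `A`, so the points of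
  -- `B` before and after it are at most `r + e + r ≤ a` apart. Here `w` is the last point visited
  -- in `B` and `z` the first point of the current excursion.
  have key : ∀ x ∈ B, ∀ y ∈ rComponent r (A ∪ B) x, y ∈ rComponent a B x ∨
      ∃ z ∈ A, ∃ w ∈ rComponent a B x, nndist w z ≤ r ∧ y ∈ rComponent r A z := by
    intro x hx y hy
    induction hy with
    | refl => exact Or.inl (mem_rComponent_self a B x)
    | @tail y y' _ h ih =>
      obtain ⟨_, hy', hd⟩ := h
      rcases ih with ih | ⟨z, hz, w, hw, hwz, hyz⟩
      · rcases hy' with hy' | hy'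
        · exact Or.inr ⟨y', hy', y, ih, hd, mem_rComponent_self r A y'⟩
        · refine Or.inl (rComponent_step ih (rComponent_subset hx ih) hy' (hd.trans ?_))
          refine le_trans ?_ ha
          rw [two_mul]
          exact le_add_left le_self_add
      · rcases hy' with hy' | hy'
        · exact Or.inr ⟨z, hz, w, hw, hwz, rComponent_step hyz (rComponent_subset hz hyz) hy' hd⟩
        · refine Or.inl (rComponent_step hw (rComponent_subset hx hw) hy' (le_trans ?_ ha))
          have h1 := nndist_triangle w z y'
          have h2 := nndist_triangle z y y'
          have h3 := hA z hz z (mem_rComponent_self r A z) y hyz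
          calc nndist w y' ≤ r + (e + r) :=
                h1.trans (add_le_add hwz (h2.trans (add_le_add h3 hd)))
            _ = e + 2 * r := by ring
  have near : ∀ x ∈ B, ∀ y ∈ rComponent r (A ∪ B) x,
      ∃ w ∈ rComponent a B x, nndist y w ≤ e + r := by
    intro x hx y hy
    rcases key x hx y hy with h | ⟨z, hz, w, hw, hwz, hyz⟩
    · exact ⟨y, h, by simp⟩
    · refine ⟨w, hw, (nndist_triangle y z w).trans (add_le_add ?_ ?_)⟩
      · exact hA z hz y hyz z (mem_rComponent_self r A z)
      · rwa [nndist_comm]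
  intro x hx
  by_cases hK : ∃ z ∈ rComponent r (A ∪ B) x, z ∈ B
  · obtain ⟨z, hz, hzB⟩ := hK
    rw [← rComponent_eq hz]
    intro y hy y' hy'
    obtain ⟨w, hw, hyw⟩ := near z hzB y hy
    obtain ⟨w', hw', hyw'⟩ := near z hzB y' hy'
    calc nndist y y' ≤ nndist y w + (nndist w w' + nndist w' y') :=
          (nndist_triangle y w y').trans (add_le_add le_rfl (nndist_triangle w w' y'))
      _ ≤ (e + r) + (b + (e + r)) := by
          refine add_le_add hyw (add_le_add (hB z hzB w hw w' hw') ?_)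
          rwa [nndist_comm]
      _ = b + 2 * (e + r) := by ring
  · push Not at hK
    have hsub : rComponent r (A ∪ B) x ⊆ A := fun y hy =>
      (rComponent_subset hx hy).resolve_right (hK y hy)
    refine (hA x (hsub (mem_rComponent_self _ _ _))).mono ?_ (rComponent_subset_rComponent hsub)
    rw [two_mul]
    exact le_add_left (le_add_left le_self_add)

/-- The union theorem for finitely many sets at nested scales. -/
theorem ComponentsBounded.iUnion {r : ℝ≥0} {a b e : ℕ → ℝ≥0} {N : ℕ} {E : Fin N → Set X}
    (hE : ∀ t : Fin N, ComponentsBounded (a t) (b t) (E t))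
    (ha : ∀ t < N, e t + 2 * r ≤ a t) (he : ∀ t < N, b t + 2 * (e t + r) ≤ e (t + 1)) :
    ComponentsBounded r (e N) (⋃ t, E t) := by
  induction N with
  | zero => intro x hx; simp at hx
  | succ N ih =>
    -- `e t` bounds the union of the first `t` sets; `e 0` is unconstrained below because the empty
    -- union has no components.
    have h1 := ih (E := fun t => E t.castSucc) (fun t => hE t.castSucc)
      (fun t ht => ha t (by omega)) (fun t ht => he t (by omega))
    have h2 := h1.union (hE (Fin.last N)) (ha N (by omega))
    refine h2.mono le_rfl (he N (by omega)) ?_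
    intro x hx
    obtain ⟨t, ht⟩ := Set.mem_iUnion.1 hx
    induction t using Fin.lastCases with
    | last => exact Or.inr ht
    | cast t => exact Or.inl (Set.mem_iUnion.2 ⟨t, ht⟩)

/-- The `s`-neighbourhood of a set with bounded `3 s`-components has bounded `s`-components. -/
theorem ComponentsBounded.thicken {s C : ℝ≥0} {B : Set X} (hB : ComponentsBounded (3 * s) C B) :
    ComponentsBounded s (C + 2 * s) {y | ∃ b ∈ B, nndist y b ≤ s} := by
  rintro x ⟨b, hb, hxb⟩
  have key : ∀ y ∈ rComponent s {y | ∃ b ∈ B, nndist y b ≤ s} x,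
      ∃ c ∈ rComponent (3 * s) B b, nndist y c ≤ s := by
    intro y hy
    induction hy with
    | refl => exact ⟨b, mem_rComponent_self _ _ _, hxb⟩
    | @tail y y' _ h ih =>
      obtain ⟨c, hc, hyc⟩ := ih
      obtain ⟨_, ⟨c', hc', hyc'⟩, hd⟩ := h
      refine ⟨c', rComponent_step hc (rComponent_subset hb hc) hc' ?_, hyc'⟩
      rw [nndist_comm] at hyc
      calc nndist c c' ≤ nndist c y + (nndist y y' + nndist y' c') :=
            (nndist_triangle c y c').trans (add_le_add le_rfl (nndist_triangle y y' c'))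
        _ ≤ s + (s + s) := add_le_add hyc (add_le_add hd hyc')
        _ = 3 * s := by ring
  intro y hy y' hy'
  obtain ⟨c, hc, hyc⟩ := key y hy
  obtain ⟨c', hc', hyc'⟩ := key y' hy'
  rw [nndist_comm] at hyc'
  calc nndist y y' ≤ nndist y c + (nndist c c' + nndist c' y') :=
        (nndist_triangle y c y').trans (add_le_add le_rfl (nndist_triangle c c' y'))
    _ ≤ s + (C + s) := add_le_add hyc (add_le_add (hB b hb c hc c' hc') hyc')
    _ = C + 2 * s := by ring

/-! ### Kolmogorov's trick; passing between covers and decompositions. -/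

/-- Kolmogorov's trick: adding one more set to a decomposition of the whole space. -/
theorem HasDecomposition.succ {n k : ℕ} {s C : ℝ≥0} (hk : n < k)
    (h : HasDecomposition n k (3 * s) C (Set.univ : Set X)) :
    HasDecomposition n (k + 1) s (C + 2 * s) (Set.univ : Set X) := by
  obtain ⟨B, -, hb, hn⟩ := h
  let B' : Fin k → Set X := fun i => {y | ∃ b ∈ B i, nndist y b ≤ s}
  -- The points for which thickening gains no index. Outside `L` the multiplicity grows by
  -- thickening; on `L` the extra set `L` itself supplies the increment.
  let L : Set X := {y | ∀ i, y ∈ B' i → y ∈ B i}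
  have hBB' : ∀ i, B i ⊆ B' i := fun i y hy => ⟨y, hy, by simp⟩
  have hcount : ∀ x, k + 1 - n ≤
      {i | x ∈ (Fin.snoc B' L : Fin (k + 1) → Set X) i}.ncard := by
    intro x
    have h0 := hn x (Set.mem_univ x)
    have hsub : {i | x ∈ B i} ⊆ {i | x ∈ B' i} := fun i hi => hBB' i hi
    have hinj : Function.Injective (Fin.castSucc : Fin k → Fin (k + 1)) :=
      Fin.castSucc_injective k
    have himg : Fin.castSucc '' {i | x ∈ B' i} ⊆
        {i | x ∈ (Fin.snoc B' L : Fin (k + 1) → Set X) i} := by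
      rintro _ ⟨i, hi, rfl⟩
      simpa using hi
    have hc := Set.ncard_image_of_injective {i | x ∈ B' i} hinj
    by_cases hx : x ∈ L
    · have hlast : Fin.last k ∉ Fin.castSucc '' {i | x ∈ B' i} := by
        rintro ⟨i, -, hi⟩
        exact (Fin.castSucc_lt_last i).ne hi
      have h1 := Set.ncard_insert_of_notMem hlast
      have h2 : insert (Fin.last k) (Fin.castSucc '' {i | x ∈ B' i}) ⊆
          {i | x ∈ (Fin.snoc B' L : Fin (k + 1) → Set X) i} := by
        refine Set.insert_subset ?_ himg
        simpa using hx
      have h3 := Set.ncard_le_ncard h2 (Set.toFinite _)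
      have h4 := Set.ncard_le_ncard hsub (Set.toFinite _)
      omega
    · have hss : {i | x ∈ B i} ⊂ {i | x ∈ B' i} := by
        refine Set.ssubset_iff_subset_ne.2 ⟨hsub, fun heq => hx fun i hi => ?_⟩
        have : i ∈ {i | x ∈ B i} := heq ▸ hi
        exact this
      have h3 := Set.ncard_lt_ncard hss (Set.toFinite _)
      have h4 := Set.ncard_le_ncard himg (Set.toFinite _)
      omega
  refine ⟨Fin.snoc B' L, ?_, ?_, fun x _ => hcount x⟩
  · refine (Set.eq_univ_of_forall fun x => ?_).symm
    have h0 := hcount x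
    obtain ⟨i, hi⟩ := Set.nonempty_of_ncard_ne_zero
      (show {i | x ∈ (Fin.snoc B' L : Fin (k + 1) → Set X) i}.ncard ≠ 0 by omega)
    exact Set.mem_iUnion.2 ⟨i, hi⟩
  · intro i
    induction i using Fin.lastCases with
    | cast i => simpa using (hb i).thicken
    | last =>
      rw [Fin.snoc_last]
      intro x hx
      have h0 := hn x (Set.mem_univ x)
      obtain ⟨i, hi⟩ := Set.nonempty_of_ncard_ne_zero
        (show {i | x ∈ B i}.ncard ≠ 0 by omega)
      -- A chain in `L` cannot leave `B i`: its next point is within `s` of `B i`, hence in `B' i`,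
      -- hence in `B i` by definition of `L`.
      have hsub : rComponent s L x ⊆ B i := by
        intro y hy
        induction hy with
        | refl => exact hi
        | @tail y y' _ h ih =>
          exact h.2.1 i ⟨y, ih, by rw [nndist_comm]; exact h.2.2⟩
      refine (hb i x hi).mono le_self_add ((rComponent_subset_rComponent hsub).trans ?_)
      refine rComponent_mono ?_ subset_rfl x
      exact le_mul_of_one_le_left zero_le (by norm_num)

theorem HasColoredCover.hasDecomposition {n : ℕ} {s C : ℝ≥0} (h : HasColoredCover X n s C) :
    HasDecomposition n (n + 1) s C (Set.univ : Set X) := by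
  obtain ⟨𝒰, hcov, hdis, hbd⟩ := h
  refine ⟨fun i => ⋃₀ 𝒰 i, ?_, ?_, ?_⟩
  · refine (Set.eq_univ_of_forall fun x => ?_).symm
    obtain ⟨i, U, hU, hx⟩ := hcov x
    exact Set.mem_iUnion.2 ⟨i, U, hU, hx⟩
  · rintro i x ⟨U, hU, hx⟩
    refine (hbd i U hU).mono le_rfl fun y hy => ?_
    induction hy with
    | refl => exact hx
    | @tail y z _ h ih =>
      obtain ⟨-, ⟨V, hV, hz⟩, hd⟩ := h
      by_cases hUV : U = V
      · rwa [hUV]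
      · have h1 := hdis i U hU V hV hUV
        have h2 : setEDist U V ≤ edist y z := (iInf₂_le y ih).trans (iInf₂_le z hz)
        have h3 := h1.trans_le h2
        rw [edist_nndist, ENNReal.coe_lt_coe] at h3
        exact absurd hd h3.not_ge
  · intro x _
    obtain ⟨i, U, hU, hx⟩ := hcov x
    have : 0 < {i | x ∈ ⋃₀ 𝒰 i}.ncard :=
      (Set.ncard_pos (Set.toFinite _)).2 ⟨i, U, hU, hx⟩
    change n + 1 - n ≤ {i | x ∈ ⋃₀ 𝒰 i}.ncard
    omega

/-- Points of distinct `2 * s`-components of one set are more than `2 * s` apart, but the infimum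
only inherits `≥ 2 * s`. The factor 2 and `0 < s` restore the strict inequality with `s`. -/
theorem hasColoredCover_of_components {N : ℕ} {s C : ℝ≥0} (hs : 0 < s) (B : Fin (N + 1) → Set X)
    (hcov : ∀ x, ∃ i, x ∈ B i) (hB : ∀ i, ComponentsBounded (2 * s) C (B i)) :
    HasColoredCover X N s C := by
  refine ⟨fun i => rComponent (2 * s) (B i) '' B i, ?_, ?_, ?_⟩
  · intro x
    obtain ⟨i, hi⟩ := hcov x
    exact ⟨i, _, ⟨x, hi, rfl⟩, mem_rComponent_self _ _ _⟩
  · rintro i _ ⟨x, hx, rfl⟩ _ ⟨y, hy, rfl⟩ hne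
    refine lt_of_lt_of_le (b := ((2 * s : ℝ≥0) : ℝ≥0∞)) ?_ ?_
    · rw [ENNReal.coe_lt_coe]
      exact lt_mul_of_one_lt_left hs (by norm_num)
    · refine le_iInf₂ fun u hu => le_iInf₂ fun v hv => ?_
      rw [edist_nndist, ENNReal.coe_le_coe]
      by_contra! hlt
      apply hne
      rw [← rComponent_eq hu, ← rComponent_eq hv]
      exact (rComponent_eq_of_nndist_le (rComponent_subset hx hu) (rComponent_subset hy hv)
        hlt.le).symm
  · rintro i _ ⟨x, hx, rfl⟩
    exact hB i x hx

theorem HasColoredCover.mono {n : ℕ} {s s' C C' : ℝ≥0} (h : HasColoredCover X n s C)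
    (hs : s' ≤ s) (hC : C ≤ C') : HasColoredCover X n s' C' := by
  obtain ⟨𝒰, hcov, hdis, hbd⟩ := h
  exact ⟨𝒰, hcov,
    fun i U hU V hV hne => (ENNReal.coe_le_coe.2 hs).trans_lt (hdis i U hU V hV hne),
    fun i U hU => (hbd i U hU).mono hC subset_rfl⟩

/-! ### Colour selection at fixed scales. -/

/-- The geometric part of the Hurewicz theorem, at fixed scales: small sets of `Y` in `m + n + 1`
colours are used to select, colour by colour, parts of decompositions of the preimages of large
sets of `Y`. -/
theorem exists_cover_componentsBounded (f : X → Y) {m n : ℕ} {r p q R : ℝ≥0} {a b e : ℕ → ℝ≥0}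
    (hf : ∀ x y, nndist x y ≤ r → nndist (f x) (f y) ≤ p)
    (hZ : HasDecomposition n (m + n + 1) p q (Set.univ : Set Y))
    (hY : HasDecomposition n (n + 1) q R (Set.univ : Set Y))
    (hdec : ∀ t < n + 1, ∀ A : Set X, InftyBounded f R A →
      HasDecomposition m (m + n + 1) (a t) (b t) A)
    (ha : ∀ t < n + 1, e t + 2 * r ≤ a t)
    (he : ∀ t < n + 1, b t + 2 * (e t + r) ≤ e (t + 1)) :
    ∃ B : Fin (m + n + 1) → Set X, (∀ x, ∃ i, x ∈ B i) ∧
      ∀ i, ComponentsBounded r (e (n + 1)) (B i) := by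
  obtain ⟨Z, -, hZb, hZn⟩ := hZ
  obtain ⟨V, hVcov, hVb, -⟩ := hY
  -- The decomposition is chosen as a function of the set alone, so points over the same component
  -- of `V t` share it; sets that are not `(∞, R)`-bounded get a dummy value.
  have hdec' : ∀ (t : Fin (n + 1)) (A : Set X), ∃ B : Fin (m + n + 1) → Set X,
      InftyBounded f R A → (∀ i, ComponentsBounded (a t) (b t) (B i)) ∧
        ∀ x ∈ A, m + n + 1 - m ≤ {i | x ∈ B i}.ncard := by
    intro t A
    by_cases hA : InftyBounded f R A
    · obtain ⟨B, -, hB⟩ := hdec t t.2 A hA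
      exact ⟨B, fun _ => hB⟩
    · exact ⟨fun _ => ∅, fun h => absurd h hA⟩
  choose P hP using hdec'
  have hbd : ∀ t, ∀ y ∈ V t, InftyBounded f R (f ⁻¹' rComponent q (V t) y) :=
    fun t y hy x hx x' hx' => hVb t y hy (f x) hx (f x') hx'
  refine ⟨fun i => {x | f x ∈ Z i ∧ ∃ t, f x ∈ V t ∧
    x ∈ P t (f ⁻¹' rComponent q (V t) (f x)) i}, fun x => ?_, fun i x hx => ?_⟩
  · obtain ⟨t, ht⟩ := Set.mem_iUnion.1 (hVcov ▸ Set.mem_univ (f x))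
    have h1 := (hP t _ (hbd t (f x) ht)).2 x (mem_rComponent_self _ _ _)
    have h2 := hZn (f x) (Set.mem_univ _)
    -- Pigeonhole: index sets of sizes at least `m + 1` and `n + 1` among `m + n + 1` indices must
    -- meet.
    have h3 := Set.ncard_union_add_ncard_inter {i | f x ∈ Z i}
      {i | x ∈ P t (f ⁻¹' rComponent q (V t) (f x)) i}
    have h4 := Set.ncard_le_card ({i | f x ∈ Z i} ∪
      {i | x ∈ P t (f ⁻¹' rComponent q (V t) (f x)) i})
    rw [Nat.card_eq_fintype_card, Fintype.card_fin] at h4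
    obtain ⟨i, hi, hi'⟩ := Set.nonempty_of_ncard_ne_zero (show ({i | f x ∈ Z i} ∩
      {i | x ∈ P t (f ⁻¹' rComponent q (V t) (f x)) i}).ncard ≠ 0 by omega)
    exact ⟨i, hi, t, ht, hi'⟩
  · set W : Set X := {x | f x ∈ Z i ∧ ∃ t, f x ∈ V t ∧
      x ∈ P t (f ⁻¹' rComponent q (V t) (f x)) i}
    have himg : ∀ y ∈ rComponent r W x, f y ∈ rComponent p (Z i) (f x) := by
      intro y hy
      induction hy with
      | refl => exact mem_rComponent_self _ _ _
      | tail _ h ih => exact rComponent_step ih h.1.1 h.2.1.1 (hf _ _ h.2.2)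
    have hclose : ∀ y ∈ rComponent r W x, ∀ z ∈ rComponent r W x, nndist (f y) (f z) ≤ q :=
      fun y hy z hz => hZb i (f x) hx.1 (f y) (himg y hy) (f z) (himg z hz)
    -- By `hclose`, all points of the component whose images lie in `V t` have them in a single
    -- `q`-component of `V t`, so one decomposition serves them all. If there are no such points,
    -- `E` is empty.
    have hE : ∀ t : Fin (n + 1), ∃ E : Set X, ComponentsBounded (a t) (b t) E ∧
        ∀ y ∈ rComponent r W x, f y ∈ V t →
          P t (f ⁻¹' rComponent q (V t) (f y)) i ⊆ E := by
      intro t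
      by_cases hz : ∃ z ∈ rComponent r W x, f z ∈ V t
      · obtain ⟨z, hz, hzt⟩ := hz
        refine ⟨P t (f ⁻¹' rComponent q (V t) (f z)) i,
          (hP t _ (hbd t (f z) hzt)).1 i, fun y hy hyt => ?_⟩
        rw [rComponent_eq_of_nndist_le hzt hyt (hclose z hz y hy)]
      · exact ⟨∅, fun _ h => absurd h (Set.notMem_empty _),
          fun y hy hyt => absurd ⟨y, hy, hyt⟩ hz⟩
    choose E hEb hEs using hE
    have hsub : rComponent r W x ⊆ ⋃ t, E t := by
      intro y hy
      obtain ⟨-, t, hyt, hyP⟩ := rComponent_subset hx hy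
      exact Set.mem_iUnion.2 ⟨t, hEs t y hy hyt hyP⟩
    exact (ComponentsBounded.iUnion hEb ha he x (hsub (mem_rComponent_self _ _ _))).mono le_rfl
      (rComponent_subset_rComponent hsub)

end Components

/-! ### Semigroups of functions along a filter of scales -/

/-- The properties common to large scale and global control semigroups, with `l` the filter of
the relevant scales. -/
structure IsScaleSemigroup (l : Filter ℝ≥0) (S : Set (ℝ≥0 → ℝ≥0)) : Prop where
  monotone : ∀ g ∈ S, Monotone g
  le_self : ∀ g ∈ S, ∀ᶠ x in l, x ≤ g x
  tendsto : ∀ g ∈ S, Tendsto g l l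
  mul_mem : ∀ c : ℝ≥0, 1 ≤ c → (fun x => c * x) ∈ S
  comp_mem : ∀ g₁ ∈ S, ∀ g₂ ∈ S, g₁ ∘ g₂ ∈ S

theorem tendsto_const_mul_atTop_nnreal {c : ℝ≥0} (hc : 1 ≤ c) :
    Tendsto (fun x : ℝ≥0 => c * x) atTop atTop :=
  tendsto_atTop_mono (fun _ => le_mul_of_one_le_left zero_le hc) tendsto_id

theorem isLargeDimControl_const_mul {c : ℝ≥0} (hc : 1 ≤ c) :
    IsLargeDimControl (fun x => c * x) where
  monotone := fun _ _ h => mul_le_mul_right h c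
  continuous := by fun_prop
  le_self := Eventually.of_forall fun _ => le_mul_of_one_le_left zero_le hc
  tendsto := tendsto_const_mul_atTop_nnreal hc

theorem isGlobalDimControl_const_mul {c : ℝ≥0} (hc : 1 ≤ c) :
    IsGlobalDimControl (fun x => c * x) :=
  ⟨{ monotone := fun _ _ h => mul_le_mul_right h c
     continuous := by fun_prop
     le_self := Eventually.of_forall fun _ => le_mul_of_one_le_left zero_le hc
     map_zero := mul_zero c }, isLargeDimControl_const_mul hc⟩

theorem IsControlSemigroup.isScaleSemigroup {S : Set (ℝ≥0 → ℝ≥0)} (hS : IsControlSemigroup S) :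
    IsScaleSemigroup atTop S where
  monotone g hg := (hS.dimControl g hg).monotone
  le_self g hg := (hS.dimControl g hg).le_self
  tendsto g hg := (hS.dimControl g hg).tendsto
  mul_mem c hc := hS.linear_mem _ (isLargeDimControl_const_mul hc)
    ⟨c, Eventually.of_forall fun _ => rfl⟩
  comp_mem := hS.comp_mem

/-- Continuity with `g 0 = 0` gives small values, and `x ≤ g x` keeps them positive. -/
theorem IsSmallDimControl.tendsto_nhdsGT {g : ℝ≥0 → ℝ≥0} (hg : IsSmallDimControl g) :
    Tendsto g (𝓝[>] 0) (𝓝[>] 0) := by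
  refine tendsto_nhdsWithin_iff.2 ⟨?_, ?_⟩
  · have := hg.continuous.tendsto 0
    rw [hg.map_zero] at this
    exact this.mono_left nhdsWithin_le_nhds
  · filter_upwards [hg.le_self, self_mem_nhdsWithin] with x hx hx0
    exact lt_of_lt_of_le hx0 hx

theorem IsGlobalControlSemigroup.isScaleSemigroup {S : Set (ℝ≥0 → ℝ≥0)}
    (hS : IsGlobalControlSemigroup S) : IsScaleSemigroup (𝓝[>] 0 ⊔ atTop) S where
  monotone g hg := (hS.dimControl g hg).1.monotone
  le_self g hg := eventually_sup.2 ⟨(hS.dimControl g hg).1.le_self, (hS.dimControl g hg).2.le_self⟩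
  tendsto g hg := (hS.dimControl g hg).1.tendsto_nhdsGT.sup_sup (hS.dimControl g hg).2.tendsto
  mul_mem c hc := hS.linear_mem _ (isGlobalDimControl_const_mul hc)
    ⟨c, Eventually.of_forall fun _ => rfl⟩ ⟨c, Eventually.of_forall fun _ => rfl⟩
  comp_mem := hS.comp_mem

/-! ### Control along a filter of scales, and the two cases. -/

section Scale

variable {X Y : Type*} [MetricSpace X] [MetricSpace Y] {l : Filter ℝ≥0}

/-- Each application of Kolmogorov's trick replaces the bound `g s` by `g (3 * s) + 2 * s`, which is
at most `2 * g (3 * s)` and so stays in the semigroup. -/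
theorem IsScaleSemigroup.exists_hasDecomposition_add {S : Set (ℝ≥0 → ℝ≥0)}
    (hS : IsScaleSemigroup l S) {n k : ℕ} (hk : n < k)
    (h : ∃ g ∈ S, ∀ᶠ s in l, HasDecomposition n k s (g s) (Set.univ : Set Y)) (j : ℕ) :
    ∃ g ∈ S, ∀ᶠ s in l, HasDecomposition n (k + j) s (g s) (Set.univ : Set Y) := by
  induction j with
  | zero => exact h
  | succ j ih =>
    obtain ⟨g, hg, hd⟩ := ih
    have h3 := hS.mul_mem 3 (by norm_num)
    refine ⟨_, hS.comp_mem _ (hS.mul_mem 2 (by norm_num)) _ (hS.comp_mem g hg _ h3), ?_⟩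
    filter_upwards [(hS.tendsto _ h3).eventually hd, (hS.tendsto _ h3).eventually (hS.le_self g hg)]
      with s hs hle
    refine (HasDecomposition.succ (by omega) hs).mono ?_
    have : 2 * s ≤ g (3 * s) := le_trans (mul_le_mul_left (by norm_num) s) hle
    calc g (3 * s) + 2 * s ≤ g (3 * s) + g (3 * s) := add_le_add le_rfl this
      _ = 2 * g (3 * s) := (two_mul _).symm

/-- The Hurewicz theorem along a filter of scales. -/
theorem IsScaleSemigroup.exists_hasColoredCover {S₁ S₂ : Set (ℝ≥0 → ℝ≥0)}
    (hS₁ : IsScaleSemigroup l S₁) (hS₂ : IsScaleSemigroup l S₂) (hl : ∀ᶠ x in l, 0 < x)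
    (f : X → Y) {m n : ℕ}
    (hf : ∃ ρ ∈ S₂, ∀ᶠ s in l, ∀ x y, nndist x y ≤ s → nndist (f x) (f y) ≤ ρ s)
    (hY : ∃ g ∈ S₂, ∀ᶠ s in l, HasColoredCover Y n s (g s))
    (hD : ∀ ρ ∈ S₁, ∀ δ ∈ S₂, ∃ ρ' ∈ S₁, ∀ᶠ s in l, ∀ A : Set X, InftyBounded f (δ s) A →
      HasDecomposition m (m + n + 1) (ρ s) (ρ' s) A) :
    ∃ g ∈ S₁, ∀ᶠ s in l, HasColoredCover X (m + n) s (g s) := by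
  obtain ⟨ρ, hρ, hρf⟩ := hf
  obtain ⟨g, hg, hgY⟩ := hY
  have hgY' : ∀ᶠ s in l, HasDecomposition n (n + 1) s (g s) (Set.univ : Set Y) :=
    hgY.mono fun s hs => hs.hasDecomposition
  obtain ⟨γ, hγ, hγY⟩ := hS₂.exists_hasDecomposition_add (Nat.lt_succ_self n) ⟨g, hg, hgY'⟩ m
  have hnm : n + 1 + m = m + n + 1 := by omega
  rw [Nat.succ_eq_add_one, hnm] at hγY
  have hδ : g ∘ γ ∘ ρ ∈ S₂ := hS₂.comp_mem g hg _ (hS₂.comp_mem γ hγ ρ hρ)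
  -- One stage of the nested scales: `a = 3e` absorbs `e + 2s`, the control function yields `b`, and
  -- `e' = 5 (b ∘ e)` works because `b s`, `e s` and `s` are all at most `b (e s)`. Bundling in `S₁`
  -- makes `e ↦ e'` a map that can be iterated.
  have hstep : ∀ e : S₁, ∃ a b e' : S₁, ∀ᶠ s in l,
      (∀ A : Set X, InftyBounded f ((g ∘ γ ∘ ρ) s) A →
        HasDecomposition m (m + n + 1) (a.1 s) (b.1 s) A) ∧
      e.1 s + 2 * s ≤ a.1 s ∧ b.1 s + 2 * (e.1 s + s) ≤ e'.1 s := by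
    rintro ⟨e, he⟩
    have ha := hS₁.comp_mem _ (hS₁.mul_mem 3 (by norm_num)) e he
    obtain ⟨b, hb, hab⟩ := hD _ ha _ hδ
    refine ⟨⟨_, ha⟩, ⟨b, hb⟩, ⟨_, hS₁.comp_mem _ (hS₁.mul_mem 5 (by norm_num)) _
      (hS₁.comp_mem b hb e he)⟩, ?_⟩
    filter_upwards [hab, hS₁.le_self e he, (hS₁.tendsto e he).eventually (hS₁.le_self b hb)]
      with s h1 h2 h3
    refine ⟨h1, ?_, ?_⟩
    · calc e s + 2 * s ≤ e s + 2 * e s := by gcongr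
        _ = 3 * e s := by ring
    · have h4 : b s ≤ b (e s) := hS₁.monotone b hb h2
      calc b s + 2 * (e s + s) ≤ b (e s) + 2 * (b (e s) + b (e s)) := by
            gcongr
            exact h2.trans h3
        _ = 5 * b (e s) := by ring
  choose a b F hF using hstep
  let e : ℕ → S₁ := fun t => F^[t] ⟨_, hS₁.mul_mem 1 le_rfl⟩
  have he : ∀ t, e (t + 1) = F (e t) := fun t => Function.iterate_succ_apply' F t _
  -- Only `n + 1` stages are needed, so finitely many eventual conditions hold simultaneously.
  have hall : ∀ᶠ s in l, ∀ t ∈ Finset.range (n + 1),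
      (∀ A : Set X, InftyBounded f ((g ∘ γ ∘ ρ) s) A →
        HasDecomposition m (m + n + 1) ((a (e t)).1 s) ((b (e t)).1 s) A) ∧
      (e t).1 s + 2 * s ≤ (a (e t)).1 s ∧
      (b (e t)).1 s + 2 * ((e t).1 s + s) ≤ (e (t + 1)).1 s := by
    refine (Filter.eventually_all_finset _).2 fun t _ => ?_
    rw [he]
    exact hF (e t)
  -- Components are needed at scale `2 * s` to obtain an `s`-disjoint cover.
  have h2 := hS₁.mul_mem 2 (by norm_num)
  have hmain : ∀ᶠ s in l, ∃ B : Fin (m + n + 1) → Set X, (∀ x, ∃ i, x ∈ B i) ∧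
      ∀ i, ComponentsBounded s ((e (n + 1)).1 s) (B i) := by
    filter_upwards [hall, hρf, (hS₂.tendsto ρ hρ).eventually hγY,
      (hS₂.tendsto _ (hS₂.comp_mem γ hγ ρ hρ)).eventually hgY'] with s h1 h2 h3 h4
    exact exists_cover_componentsBounded f (a := fun t => (a (e t)).1 s)
      (b := fun t => (b (e t)).1 s) (e := fun t => (e t).1 s) h2 h3 h4
      (fun t ht => (h1 t (Finset.mem_range.2 ht)).1)
      (fun t ht => (h1 t (Finset.mem_range.2 ht)).2.1)
      (fun t ht => (h1 t (Finset.mem_range.2 ht)).2.2)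
  refine ⟨_, hS₁.comp_mem _ (e (n + 1)).2 _ h2, ?_⟩
  filter_upwards [(hS₁.tendsto _ h2).eventually hmain, hl] with s ⟨B, hB, hb⟩ hs
  exact hasColoredCover_of_components hs B hB hb

theorem asdimLE_of_isCoarseMap (f : X → Y) {m n : ℕ} {S₁ S₂ : Set (ℝ≥0 → ℝ≥0)}
    (hS₁ : IsControlSemigroup S₁) (hS₂ : IsControlSemigroup S₂) (hf : IsCoarseMap S₂ f)
    (hY : AsdimLE Y S₂ n) {D : ℝ≥0 → ℝ≥0 → ℝ≥0}
    (hD : IsControlFunction S₁ S₂ m (m + n + 1) f D) : AsdimLE X S₁ (m + n) := by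
  refine hS₁.isScaleSemigroup.exists_hasColoredCover hS₂.isScaleSemigroup
    (eventually_gt_atTop 0) f ?_ hY ?_
  · obtain ⟨ρ, ⟨hmono, -, -, g, hg, hle⟩, hρ⟩ := hf
    refine ⟨g, hg, hle.mono fun s hs x y hxy => ?_⟩
    exact (hρ x y).trans ((hmono hxy).trans hs)
  · obtain ⟨hpair, s₀, -, hs₀⟩ := hD
    intro ρ hρ δ hδ
    obtain ⟨ρ', hρ', hle⟩ := hpair ρ hρ δ hδ
    refine ⟨ρ', hρ', ?_⟩
    filter_upwards [hle, (hS₁.dimControl ρ hρ).tendsto.eventually_ge_atTop s₀,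
      (hS₂.dimControl δ hδ).tendsto.eventually_ge_atTop s₀] with s h1 h2 h3 A hA
    exact (hs₀ _ _ h2 h3 A hA).mono h1

/-- Covers at scales near `0` and near `∞` yield covers at all scales. -/
theorem IsGlobalControlSemigroup.globalDimLE {S : Set (ℝ≥0 → ℝ≥0)}
    (hS : IsGlobalControlSemigroup S) {N : ℕ}
    (h : ∃ g ∈ S, ∀ᶠ s in 𝓝[>] 0 ⊔ atTop, HasColoredCover X N s (g s)) : GlobalDimLE X S N := by
  obtain ⟨g, hg, hcov⟩ := h
  obtain ⟨h0, hinf⟩ := eventually_sup.1 hcov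
  obtain ⟨b, hb⟩ := eventually_atTop.1 hinf
  obtain ⟨a, ha0, ha⟩ := mem_nhdsGT_iff_exists_Ioc_subset.1
    (h0.and (hS.dimControl g hg).1.le_self)
  have hga : 0 < g a := lt_of_lt_of_le ha0 (ha ⟨ha0, le_rfl⟩).2
  -- For `a < s < b` the cover at scale `b` is reused. Its bound `g b` equals `(g b / g a) * g a`,
  -- and `g a ≤ g s`; the maximum with 1 keeps the linear factor in the semigroup.
  have hmul := hS.isScaleSemigroup.mul_mem (max 1 (g b / g a)) (le_max_left _ _)
  refine ⟨_, hS.comp_mem _ hmul g hg, fun s hs => ?_⟩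
  have hle : g s ≤ max 1 (g b / g a) * g s :=
    le_mul_of_one_le_left zero_le (le_max_left _ _)
  rcases le_or_gt s a with hsa | hsa
  · exact (ha ⟨hs, hsa⟩).1.mono le_rfl hle
  rcases le_or_gt b s with hbs | hbs
  · exact (hb s hbs).mono le_rfl hle
  · refine (hb b le_rfl).mono hbs.le ?_
    calc g b = g b / g a * g a := (div_mul_cancel₀ _ hga.ne').symm
      _ ≤ max 1 (g b / g a) * g s :=
        mul_le_mul' (le_max_right _ _) ((hS.dimControl g hg).1.monotone hsa.le)

theorem globalDimLE_of_isGlobalMap (f : X → Y) {m n : ℕ} {S₁ S₂ : Set (ℝ≥0 → ℝ≥0)}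
    (hS₁ : IsGlobalControlSemigroup S₁) (hS₂ : IsGlobalControlSemigroup S₂)
    (hf : IsGlobalMap S₂ f) (hY : GlobalDimLE Y S₂ n) {D : ℝ≥0 → ℝ≥0 → ℝ≥0}
    (hD : IsGlobalControlFunction S₁ S₂ m (m + n + 1) f D) : GlobalDimLE X S₁ (m + n) := by
  have hpos : ∀ᶠ x : ℝ≥0 in 𝓝[>] 0 ⊔ atTop, 0 < x :=
    eventually_sup.2 ⟨self_mem_nhdsWithin, eventually_gt_atTop 0⟩
  refine hS₁.globalDimLE (hS₁.isScaleSemigroup.exists_hasColoredCover hS₂.isScaleSemigroup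
    hpos f ?_ ?_ ?_)
  · obtain ⟨ρ, ⟨hmono, -, -, -, g, hg, hle⟩, hρ⟩ := hf
    refine ⟨g, hg, (eventually_sup.2 hle).mono fun s hs x y hxy => ?_⟩
    exact (hρ x y).trans ((hmono hxy).trans hs)
  · obtain ⟨g, hg, hcov⟩ := hY
    exact ⟨g, hg, hpos.mono hcov⟩
  · obtain ⟨hpair, ⟨s₁, hs₁, hsmall⟩, s₀, -, hlarge⟩ := hD
    intro ρ hρ δ hδ
    obtain ⟨ρ', hρ', hle₀, hle⟩ := hpair ρ hρ δ hδ
    have hIoc : Set.Ioc 0 s₁ ∈ 𝓝[>] (0 : ℝ≥0) := Ioc_mem_nhdsGT hs₁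
    refine ⟨ρ', hρ', eventually_sup.2 ⟨?_, ?_⟩⟩
    · filter_upwards [hle₀, (hS₁.dimControl ρ hρ).1.tendsto_nhdsGT hIoc,
        (hS₂.dimControl δ hδ).1.tendsto_nhdsGT hIoc] with s h1 h2 h3 A hA
      exact (hsmall _ _ h2.1 h2.2 h3.1 h3.2 A hA).mono h1
    · filter_upwards [hle, (hS₁.dimControl ρ hρ).2.tendsto.eventually_ge_atTop s₀,
        (hS₂.dimControl δ hδ).2.tendsto.eventually_ge_atTop s₀] with s h1 h2 h3 A hA
      exact (hlarge _ _ h2 h3 A hA).mono h1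

end Scale

end SemigroupDim

theorem mainTheorem2 {X Y : Type*} [MetricSpace X] [MetricSpace Y] (f : X → Y)
    (m n k : ℕ) (hk : k = m + n + 1) :
    (∀ S₁ S₂ : Set (ℝ≥0 → ℝ≥0),
      SemigroupDim.IsControlSemigroup S₁ → SemigroupDim.IsControlSemigroup S₂ →
      SemigroupDim.IsCoarseMap S₂ f → SemigroupDim.AsdimLE Y S₂ n →
      (∃ D : ℝ≥0 → ℝ≥0 → ℝ≥0, SemigroupDim.IsControlFunction S₁ S₂ m k f D) →
      SemigroupDim.AsdimLE X S₁ (m + n)) ∧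
    (∀ S₁ S₂ : Set (ℝ≥0 → ℝ≥0),
      SemigroupDim.IsGlobalControlSemigroup S₁ → SemigroupDim.IsGlobalControlSemigroup S₂ →
      SemigroupDim.IsGlobalMap S₂ f → SemigroupDim.GlobalDimLE Y S₂ n →
      (∃ D : ℝ≥0 → ℝ≥0 → ℝ≥0, SemigroupDim.IsGlobalControlFunction S₁ S₂ m k f D) →
      SemigroupDim.GlobalDimLE X S₁ (m + n)) := by
  subst hk
  exact ⟨fun _ _ h₁ h₂ hf hY ⟨_, hD⟩ => SemigroupDim.asdimLE_of_isCoarseMap f h₁ h₂ hf hY hD,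
    fun _ _ h₁ h₂ hf hY ⟨_, hD⟩ => SemigroupDim.globalDimLE_of_isGlobalMap f h₁ h₂ hf hY hD⟩
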